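/- Work in the ring $\mathbb{C}[[t]]$ of formal power series. Let $\lambda,\gamma,x,u\in\mathbb{C}$ with $\lambda\notin\{0,-\tfrac12,-1,-\tfrac32,\dots\}$. For $f\in\mathbb{C}[[t]]$ with $f(0)=1$ and $a\in\mathbb{C}$ let $f^a=\sum_{k\ge0}\binom ak (f-1)^k$, and define the Gegenbauer polynomials by $\sum_{n\ge0}C_n^\lambda(x)t^n=(1-2xt+t^2)^{-\lambda}$. Put $$R=(1-2xt+t^2)^{1/2},\qquad U=\bigl(1-2(1-u)xt+(1-u)^2t^2\bigr)^{1/2}$$ (so $R=U=1$ at $t=0$), and let ${}_2F_1\bigl(a,b;c\mid g\bigr)=\sum_{k\ge0}\frac{(a)_k(b)_k}{(c)_k\,k!}g^k$ for $g\in\mathbb{C}[[t]]$ with $g(0)=0$, where $(a)_k=a(a+1)\cdots(a+k-1)$. Let ${}_3F_2\bigl(-n,b,c;d,e\mid u\bigr)=\sum_{k=0}^n\frac{(-n)_k(b)_k(c)_k}{(d)_k(e)_k\,k!}u^k$. Then, as equalities between power series in $t$, $$\begin{aligned} &\sum_{n=0}^\infty {}_3F_2\bigl(-n,\gamma,2\lambda-\gamma;\,2\lambda,\lambda+\tfrac12\bigm|u\bigr)\,C_n^\lambda(x)\,t^n\\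 &\quad=R^{-2\lambda}\;{}_2F_1\Bigl(\gamma,2\lambda-\gamma;\lambda+\tfrac12\Bigm|\frac{R-U+ut}{2R}\Bigr)\;{}_2F_1\Bigl(\gamma,2\lambda-\gamma;\lambda+\tfrac12\Bigm|\frac{R-U-ut}{2R}\Bigr)\\ &\quad=(U^2-u^2t^2)^{-\gamma}R^{2\gamma-2\lambda}\;{}_2F_1\Bigl(\tfrac\gamma2,\tfrac\gamma2+\tfrac12;\lambda+\tfrac12\Bigm|1-\frac{R^2}{(U-ut)^2}\Bigr)\;{}_2F_1\Bigl(\tfrac\gamma2,\tfrac\gamma2+\tfrac12;\lambda+\tfrac12\Bigm|1-\frac{R^2}{(U+ut)^2}\Bigr). \end{aligned}$$ -/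

import Mathlib

open PowerSeries

namespace BrafmanGegenbauer

noncomputable section

/-- The complex power `f ^ a = ∑ₖ (a choose k) (f - 1) ^ k` of a formal power series `f` over `ℂ`
with constant coefficient `1`; it is the branch with constant coefficient `1`. -/
def cpow (f : ℂ⟦X⟧) (a : ℂ) : ℂ⟦X⟧ :=
  (PowerSeries.binomialSeries ℂ a).subst (f - 1)

/-- The series `1 - 2 x t + t ^ 2` in the variable `t`. -/
def quad (x : ℂ) : ℂ⟦X⟧ :=
  1 - C (2 * x) * X + X ^ 2

/-- The value at `x` of the Gegenbauer polynomial of parameter `lam` and degree `n`, defined by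
the ordinary generating function `∑ₙ C_n^lam(x) t ^ n = (1 - 2 x t + t ^ 2) ^ (-lam)`. -/
def gegenbauer (lam : ℂ) (n : ℕ) (x : ℂ) : ℂ :=
  coeff n (cpow (quad x) (-lam))

/-- `R = (1 - 2 x t + t ^ 2) ^ (1 / 2)`, with `R = 1` when `t = 0`. -/
def serR (x : ℂ) : ℂ⟦X⟧ :=
  cpow (quad x) (1 / 2)

/-- `U = (1 - 2 (1 - u) x t + (1 - u) ^ 2 t ^ 2) ^ (1 / 2)`, with `U = 1` when `t = 0`. -/
def serU (x u : ℂ) : ℂ⟦X⟧ :=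
  cpow (1 - C (2 * (1 - u) * x) * X + C ((1 - u) ^ 2) * X ^ 2) (1 / 2)

/-- The Gauss series `₂F₁(a, b; c; ·)` evaluated at a formal power series `g` with constant
coefficient `0`, that is `∑ₖ (a)ₖ (b)ₖ / ((c)ₖ k!) g ^ k`. -/
def hyp2F1 (a b c : ℂ) (g : ℂ⟦X⟧) : ℂ⟦X⟧ :=
  (PowerSeries.mk (ordinaryHypergeometricCoefficient a b c)).subst g

/-- The hypergeometric function `₃F₂(a₁, a₂, a₃; b₁, b₂; z)` as the sum of its series; the sum is
finite if one of `a₁`, `a₂`, `a₃` is a nonpositive integer. -/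
def hyp3F2 (a₁ a₂ a₃ b₁ b₂ z : ℂ) : ℂ :=
  ∑' k : ℕ, (ascPochhammer ℂ k).eval a₁ * (ascPochhammer ℂ k).eval a₂ *
    (ascPochhammer ℂ k).eval a₃ /
      ((ascPochhammer ℂ k).eval b₁ * (ascPochhammer ℂ k).eval b₂ * (Nat.factorial k : ℂ)) * z ^ k

end

end BrafmanGegenbauer

open BrafmanGegenbauer

/-! Write `F` for the Gauss series with parameters `γ, 2λ-γ; λ+1/2`. Two facts give the first
equality.

Product formula (`coeff_mul_hyp_mul_hyp`): let `h_n` be the coefficients of `(1 - 2ps + es²)^(-λ)`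
in `s`, with `p = z + w - 2zw` and `e = (w - z)²`. Then `F(z) F(w) = ∑ a_n h_n`, where `a_n = (γ)_n
(2λ-γ)_n / ((2λ)_n (λ+1/2)_n)`. Since `γ + (2λ-γ) + 1 = 2(λ+1/2)`, only the eigenvalue `γ(2λ-γ)` in
the hypergeometric equation depends on `γ`, and it cancels in the difference of the operators in `z`
and `w`. That difference kills both sides (`hgegSeries_pde`), and a series it kills is determined by
its value at `w = 0`, where `h_n` is `(2λ)_n / n! * z^n`.

Taylor shift (`cpow_quad_mul_dividedDeriv`): put `q = 1 - 2xt + t²`. As `(-n)_k / k! = (-1)^k (n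
choose k)`, the left-hand side is `∑ a_k (-ut)^k G^(k)/k!` with `G = q^(-λ)`. Expanding `G(t - uts)`
in `s` shows that the `k`-th term is `a_k q^(-λ) h_k` with `p = ut(t-x)/q`, `e = u²t²/q`. The stated
arguments are the `z, w` solving these equations.

The second equality is Gauss's quadratic transformation (`hyp2F1_quadratic`) applied to each factor.
All of this is formal: identities of series come from uniqueness for differential equations or
recurrences, and each coefficient in `t` involves finitely many terms. -/

namespace BrafmanGegenbauer

/-! ### Complex powers of formal power series -/

/-- A homogeneous first-order linear equation with invertible leading coefficient has only the
zero solution with vanishing constant coefficient. -/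
theorem eq_zero_of_first_order {A : Type*} [CommRing A] [Algebra ℚ A] {f g H : A⟦X⟧}
    (hf : IsUnit f) (h : f * d⁄dX A H = g * H) (h0 : constantCoeff H = 0) : H = 0 := by
  have key : ∀ N : ℕ, (X : A⟦X⟧) ^ N ∣ H := by
    intro N
    induction N with
    | zero => simp
    | succ N ih =>
      have h1 : (X : A⟦X⟧) ^ N ∣ d⁄dX A H := by
        rw [← hf.dvd_mul_left, h]
        exact Dvd.dvd.mul_left ih g
      rw [X_pow_dvd_iff] at h1 ⊢
      intro m hm
      cases m with
      | zero => simpa using h0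
      | succ m =>
        have h2 := h1 m (by omega)
        rw [coeff_derivative] at h2
        have h3 : IsUnit ((m : A) + 1) := by
          have : ((m : A) + 1) = algebraMap ℚ A (m + 1) := by simp
          rw [this]
          exact (IsUnit.mk0 ((m : ℚ) + 1) (by positivity)).map _
        exact (h3.mul_left_eq_zero).1 h2
  ext n
  exact X_pow_dvd_iff.1 (key (n + 1)) n (by omega)

theorem succ_mul_choose (a : ℂ) (n : ℕ) :
    (n + 1 : ℂ) * Ring.choose a (n + 1) = (a - n) * Ring.choose a n := by
  have h1 := Ring.descPochhammer_eq_factorial_smul_choose a (n + 1)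
  have h2 := Ring.descPochhammer_eq_factorial_smul_choose a n
  rw [descPochhammer_succ_right, Polynomial.smeval_mul, h2] at h1
  have h3 : (Nat.factorial n : ℂ) ≠ 0 := by exact_mod_cast n.factorial_ne_zero
  apply mul_left_cancel₀ h3
  simp only [Polynomial.smeval_sub, Polynomial.smeval_X, Polynomial.smeval_natCast, nsmul_eq_mul,
    Nat.factorial_succ] at h1
  push_cast at h1
  simp only [pow_one, pow_zero, mul_one] at h1
  linear_combination -h1

theorem binomialSeries_ode (a : ℂ) :
    (1 + X) * d⁄dX ℂ (PowerSeries.binomialSeries ℂ a) = C a * PowerSeries.binomialSeries ℂ a := by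
  ext n
  rw [add_mul, one_mul, map_add, coeff_C_mul]
  cases n with
  | zero =>
    have := succ_mul_choose a 0
    simp [coeff_derivative] at this ⊢
  | succ n =>
    have := succ_mul_choose a (n + 1)
    rw [coeff_succ_X_mul, coeff_derivative, coeff_derivative]
    simp only [binomialSeries_coeff, smul_eq_mul, mul_one]
    push_cast at this ⊢
    linear_combination this

theorem hasSubst_of_constantCoeff {g : ℂ⟦X⟧} (hg : constantCoeff g = 0) : HasSubst g :=
  HasSubst.of_constantCoeff_zero' hg

theorem hasSubst_sub_one {f : ℂ⟦X⟧} (hf : constantCoeff f = 1) : HasSubst (f - 1) :=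
  hasSubst_of_constantCoeff (by simp [hf])

theorem constantCoeff_subst_of_zero {g : ℂ⟦X⟧} (hg : constantCoeff g = 0) (F : ℂ⟦X⟧) :
    constantCoeff (F.subst g : ℂ⟦X⟧) = constantCoeff F := by
  have hs := hasSubst_of_constantCoeff hg
  have h : F = (F - C (constantCoeff F)) + C (constantCoeff F) := by ring
  have h2 : constantCoeff ((F - C (constantCoeff F)).subst g : ℂ⟦X⟧) = 0 :=
    constantCoeff_subst_eq_zero hg _ (by simp)
  conv_lhs => rw [h, subst_add hs, map_add, h2, subst_C]
  simp [PowerSeries.constantCoeff]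

@[simp]
theorem constantCoeff_cpow {f : ℂ⟦X⟧} (hf : constantCoeff f = 1) (a : ℂ) :
    constantCoeff (cpow f a) = 1 := by
  rw [cpow, constantCoeff_subst_of_zero (by simp [hf]), binomialSeries_constantCoeff]

theorem subst_C' {g : ℂ⟦X⟧} (r : ℂ) : ((C r : ℂ⟦X⟧).subst g : ℂ⟦X⟧) = C r := by
  rw [subst_C]; rfl

theorem subst_one' {g : ℂ⟦X⟧} : ((1 : ℂ⟦X⟧).subst g : ℂ⟦X⟧) = 1 := by
  have := subst_C' (g := g) 1
  simpa using this

theorem derivative_cpow {f : ℂ⟦X⟧} (hf : constantCoeff f = 1) (a : ℂ) :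
    f * d⁄dX ℂ (cpow f a) = C a * d⁄dX ℂ f * cpow f a := by
  have hs := hasSubst_sub_one hf
  have h := congrArg (fun F : ℂ⟦X⟧ => (F.subst (f - 1) : ℂ⟦X⟧)) (binomialSeries_ode a)
  simp only [subst_mul hs, subst_add hs, subst_one', subst_X hs, subst_C'] at h
  rw [cpow, derivative_subst hs, map_sub, derivative_one]
  linear_combination d⁄dX ℂ f * h

theorem isUnit_of_constantCoeff {f : ℂ⟦X⟧} (hf : constantCoeff f = 1) : IsUnit f :=
  isUnit_iff_constantCoeff.2 (by simp [hf])

/-- The logarithmic derivative and the constant coefficient characterise a power; most of the power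
laws below reduce to checking this equation. -/
theorem eq_cpow {f F : ℂ⟦X⟧} (hf : constantCoeff f = 1) (a : ℂ) (hF : constantCoeff F = 1)
    (h : f * d⁄dX ℂ F = C a * d⁄dX ℂ f * F) : F = cpow f a := by
  rw [← sub_eq_zero]
  refine eq_zero_of_first_order (isUnit_of_constantCoeff hf) (g := C a * d⁄dX ℂ f) ?_ ?_
  · rw [map_sub]
    linear_combination h - derivative_cpow hf a
  · rw [map_sub, hF, constantCoeff_cpow hf, sub_self]

theorem cpow_add {f : ℂ⟦X⟧} (hf : constantCoeff f = 1) (a b : ℂ) :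
    cpow f (a + b) = cpow f a * cpow f b := by
  rw [cpow, binomialSeries_add, subst_mul (hasSubst_sub_one hf)]; rfl

theorem cpow_zero (f : ℂ⟦X⟧) : cpow f 0 = 1 := by
  rw [cpow, binomialSeries_zero, subst_one']

theorem cpow_one {f : ℂ⟦X⟧} (hf : constantCoeff f = 1) : cpow f 1 = f := by
  refine (eq_cpow hf 1 hf ?_).symm
  simp; ring

theorem cpow_mul_cpow_neg {f : ℂ⟦X⟧} (hf : constantCoeff f = 1) (a : ℂ) :
    cpow f a * cpow f (-a) = 1 := by
  rw [← cpow_add hf, add_neg_cancel, cpow_zero]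

theorem cpow_half_sq {f : ℂ⟦X⟧} (hf : constantCoeff f = 1) : cpow f (1 / 2) ^ 2 = f := by
  rw [sq, ← cpow_add hf]
  norm_num [cpow_one hf]

theorem mul_cpow {f g : ℂ⟦X⟧} (hf : constantCoeff f = 1) (hg : constantCoeff g = 1) (a : ℂ) :
    cpow (f * g) a = cpow f a * cpow g a := by
  refine (eq_cpow (by simp [hf, hg]) a ?_ ?_).symm
  · rw [map_mul, constantCoeff_cpow hf, constantCoeff_cpow hg, one_mul]
  · simp only [Derivation.leibniz, smul_eq_mul]
    linear_combination g * cpow g a * derivative_cpow hf a + f * cpow f a * derivative_cpow hg a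

theorem cpow_cpow {f : ℂ⟦X⟧} (hf : constantCoeff f = 1) (a b : ℂ) :
    cpow (cpow f a) b = cpow f (a * b) := by
  refine eq_cpow hf _ ?_ ?_
  · exact constantCoeff_cpow (constantCoeff_cpow hf a) b
  · apply (isUnit_of_constantCoeff (constantCoeff_cpow hf a)).mul_left_cancel
    rw [map_mul]
    linear_combination f * derivative_cpow (constantCoeff_cpow hf a) b +
      C b * cpow (cpow f a) b * derivative_cpow hf a

theorem cpow_subst {f g : ℂ⟦X⟧} (hf : constantCoeff f = 1) (hg : constantCoeff g = 0) (a : ℂ) :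
    ((cpow f a).subst g : ℂ⟦X⟧) = cpow (f.subst g) a := by
  have hs := hasSubst_of_constantCoeff hg
  refine eq_cpow ?_ a ?_ ?_
  · rw [constantCoeff_subst_of_zero hg, hf]
  · rw [constantCoeff_subst_of_zero hg, constantCoeff_cpow hf]
  · have h := congrArg (fun F : ℂ⟦X⟧ => (F.subst g : ℂ⟦X⟧)) (derivative_cpow hf a)
    simp only [subst_mul hs, subst_C'] at h
    rw [derivative_subst hs, derivative_subst hs]
    linear_combination d⁄dX ℂ g * h

/-! ### The Gauss equation and the quadratic transformation -/

/-- The Gauss hypergeometric series as a formal power series. -/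
noncomputable def hypSeries (a b c : ℂ) : ℂ⟦X⟧ :=
  PowerSeries.mk (ordinaryHypergeometricCoefficient a b c)

theorem ascPochhammer_eval_ne_zero {c : ℂ} (hc : ∀ k : ℕ, c + k ≠ 0) (n : ℕ) :
    (ascPochhammer ℂ n).eval c ≠ 0 := by
  induction n with
  | zero => simp
  | succ n ih =>
    rw [ascPochhammer_succ_eval]
    exact mul_ne_zero ih (hc n)

theorem coeff_hypSeries_succ (a b : ℂ) {c : ℂ} (hc : ∀ k : ℕ, c + k ≠ 0) (n : ℕ) :
    (n + 1 : ℂ) * (c + n) * coeff (n + 1) (hypSeries a b c) =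
      (a + n) * (b + n) * coeff n (hypSeries a b c) := by
  have h1 := ascPochhammer_eval_ne_zero hc n
  have h2 := hc n
  have h3 : (Nat.factorial n : ℂ) ≠ 0 := by exact_mod_cast n.factorial_ne_zero
  have h4 : (n + 1 : ℂ) ≠ 0 := by exact_mod_cast n.succ_ne_zero
  simp only [hypSeries, coeff_mk, ordinaryHypergeometricCoefficient, ascPochhammer_succ_eval,
    Nat.factorial_succ]
  push_cast
  field_simp

@[simp]
theorem constantCoeff_hypSeries (a b c : ℂ) : constantCoeff (hypSeries a b c) = 1 := by
  rw [← coeff_zero_eq_constantCoeff_apply]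
  simp [hypSeries, ordinaryHypergeometricCoefficient]

/-- On coefficients the Gauss operator becomes a two-term recurrence, which yields both the
differential equation and, when no `c + n` vanishes, uniqueness of its normalised power series
solution. -/
theorem coeff_hyp_operator (a b c : ℂ) (y : ℂ⟦X⟧) (n : ℕ) :
    coeff n (X * (1 - X) * d⁄dX ℂ (d⁄dX ℂ y) + (C c - C (a + b + 1) * X) * d⁄dX ℂ y -
      C (a * b) * y) =
    (n + 1 : ℂ) * (c + n) * coeff (n + 1) y - (a + n) * (b + n) * coeff n y := by
  obtain ⟨r, hr⟩ : ∃ r, r = a + b + 1 := ⟨_, rfl⟩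
  rw [← hr]
  have h : X * (1 - X) * d⁄dX ℂ (d⁄dX ℂ y) + (C c - C r * X) * d⁄dX ℂ y -
      C (a * b) * y = X * d⁄dX ℂ (d⁄dX ℂ y) - X * (X * d⁄dX ℂ (d⁄dX ℂ y)) + C c * d⁄dX ℂ y -
      C r * (X * d⁄dX ℂ y) - C (a * b) * y := by ring
  rw [h]
  simp only [map_sub, map_add, coeff_C_mul]
  rcases n with _ | _ | n
  · simp [coeff_derivative]
  · simp only [coeff_succ_X_mul, coeff_derivative, coeff_zero_X_mul]
    push_cast; rw [hr]; ring
  · simp only [coeff_succ_X_mul, coeff_derivative]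
    push_cast; rw [hr]; ring

theorem hypSeries_ode (a b : ℂ) {c : ℂ} (hc : ∀ k : ℕ, c + k ≠ 0) :
    X * (1 - X) * d⁄dX ℂ (d⁄dX ℂ (hypSeries a b c)) +
      (C c - C (a + b + 1) * X) * d⁄dX ℂ (hypSeries a b c) - C (a * b) * hypSeries a b c = 0 := by
  ext n
  rw [coeff_hyp_operator, coeff_hypSeries_succ a b hc, sub_self, map_zero]

theorem eq_hypSeries {a b c : ℂ} (hc : ∀ k : ℕ, c + k ≠ 0) {y : ℂ⟦X⟧}
    (hy : constantCoeff y = 1)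
    (h : X * (1 - X) * d⁄dX ℂ (d⁄dX ℂ y) + (C c - C (a + b + 1) * X) * d⁄dX ℂ y -
      C (a * b) * y = 0) : y = hypSeries a b c := by
  ext n
  induction n with
  | zero => simp [hy]
  | succ n ih =>
    have h1 := congrArg (coeff n) h
    rw [coeff_hyp_operator, ih, map_zero, ← coeff_hypSeries_succ a b hc, sub_eq_zero] at h1
    refine mul_left_cancel₀ (mul_ne_zero ?_ (hc n)) h1
    exact_mod_cast n.succ_ne_zero

/-- Gauss's quadratic transformation, in the variable of the left-hand side. -/
theorem hypSeries_quadratic (γ : ℂ) {c : ℂ} (hc : ∀ k : ℕ, c + k ≠ 0) :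
    hypSeries γ (2 * c - 1 - γ) c =
      cpow (1 - C 2 * X) (-γ) *
        (hypSeries (γ / 2) (γ / 2 + 1 / 2) c).subst (1 - ((1 - C 2 * X : ℂ⟦X⟧)⁻¹) ^ 2) := by
  set k := hypSeries (γ / 2) (γ / 2 + 1 / 2) c with hk
  set l : ℂ⟦X⟧ := 1 - C 2 * X with hl
  have hl1 : constantCoeff l = 1 := by simp [hl]
  set v := l⁻¹ with hv
  have hlv : l * v = 1 := PowerSeries.mul_inv_cancel _ (by simp [hl1])
  set g := 1 - v ^ 2 with hg
  have hv1 : constantCoeff v = 1 := by simp [hv, hl1]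
  have hg0 : constantCoeff g = 0 := by simp [hg, hv1]
  have hs := hasSubst_of_constantCoeff hg0
  have dl : d⁄dX ℂ l = - C 2 := by simp [hl]
  have dv : d⁄dX ℂ v = C 2 * v ^ 2 := by rw [hv, derivative_inv', dl]; ring
  have dg : d⁄dX ℂ g = - C 4 * v ^ 3 := by
    rw [hg, map_sub, derivative_one, derivative_pow, dv]
    have : (C 4 : ℂ⟦X⟧) = C 2 * 2 := by rw [← map_ofNat C 2, ← map_mul]; norm_num
    rw [this]; push_cast; ring
  set E := cpow l (-γ) with hE
  have dE : d⁄dX ℂ E = C (2 * γ) * v * E := by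
    have := derivative_cpow hl1 (-γ)
    rw [dl, ← hE] at this
    rw [map_mul]
    rw [map_neg] at this
    linear_combination v * this - d⁄dX ℂ E * hlv
  set K : ℂ⟦X⟧ := k.subst g with hK
  set K1 : ℂ⟦X⟧ := (d⁄dX ℂ k).subst g with hK1
  set K2 : ℂ⟦X⟧ := (d⁄dX ℂ (d⁄dX ℂ k)).subst g with hK2
  have dK : d⁄dX ℂ K = K1 * d⁄dX ℂ g := derivative_subst hs
  have dK1 : d⁄dX ℂ K1 = K2 * d⁄dX ℂ g := derivative_subst hs
  have ode : g * (1 - g) * K2 + (C c - C (γ / 2 + (γ / 2 + 1 / 2) + 1) * g) * K1 -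
      C (γ / 2 * (γ / 2 + 1 / 2)) * K = 0 := by
    have h := congrArg (fun F : ℂ⟦X⟧ => (F.subst g : ℂ⟦X⟧))
      (hypSeries_ode (γ / 2) (γ / 2 + 1 / 2) hc)
    simp only [subst_mul hs, subst_add hs, subst_sub hs, subst_one', subst_X hs, subst_C'] at h
    rw [h, ← coe_substAlgHom hs, map_zero]
  -- By uniqueness it is enough that the right-hand side solves the Gauss equation with parameters
  -- `γ, 2c-1-γ; c`.
  symm
  apply eq_hypSeries hc
  · rw [map_mul, hE, constantCoeff_cpow hl1, hK, constantCoeff_subst_of_zero hg0, hk,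
      constantCoeff_hypSeries, one_mul]
  have dh : d⁄dX ℂ (E * K) = E * (C (2 * γ) * v * K - C 4 * v ^ 3 * K1) := by
    rw [Derivation.leibniz, dK, dE, dg, smul_eq_mul, smul_eq_mul]; ring
  have ddh : d⁄dX ℂ (d⁄dX ℂ (E * K)) = E * ((C (2 * γ) * v) * (C (2 * γ) * v * K - C 4 * v ^ 3 * K1)
      + C (2 * γ) * (C 2 * v ^ 2 * K - v * (K1 * (C 4 * v ^ 3)))
      - C 4 * (C 6 * v ^ 4 * K1 - v ^ 3 * (K2 * (C 4 * v ^ 3)))) := by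
    rw [dh]
    have h6 : (C 6 : ℂ⟦X⟧) = 3 * C 2 := by rw [← map_ofNat C 3, ← map_mul]; norm_num
    simp only [Derivation.leibniz, map_sub, dK, dK1, dE, dg, dv, derivative_pow, smul_eq_mul,
      derivative_C]
    rw [h6]
    push_cast
    ring
  rw [ddh, dh]
  -- With `X` eliminated, what remains is a polynomial identity modulo `l * v = 1` and the
  -- pulled-back equation `ode`.
  have hX : (X : ℂ⟦X⟧) = C (1 / 2) * (1 - l) := by
    rw [hl]
    have : (C (1 / 2) : ℂ⟦X⟧) * C 2 = 1 := by rw [← map_mul]; norm_num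
    linear_combination - X * this
  rw [hX]
  have e2 : (C 2 : ℂ⟦X⟧) = 2 := map_ofNat C 2
  have e4 : (C 4 : ℂ⟦X⟧) = 4 := map_ofNat C 4
  have e6 : (C 6 : ℂ⟦X⟧) = 6 := map_ofNat C 6
  set i : ℂ⟦X⟧ := C (1 / 2) with hi
  have hi2 : 2 * i = 1 := by rw [hi, ← e2, ← map_mul]; norm_num
  have hd : ∀ r : ℂ, (C (r / 2) : ℂ⟦X⟧) = C r * i := fun r => by rw [hi, ← map_mul]; ring_nf
  simp only [map_add, map_sub, map_mul, hd, map_one, e2, e4, e6] at ode ⊢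
  rw [hg] at ode
  have ode' : 4 * (1 - v ^ 2) * v ^ 2 * K2 + (4 * C c - (4 * C γ + 6) * (1 - v ^ 2)) * K1 -
      (C γ ^ 2 + C γ) * K = 0 := by
    linear_combination 4 * ode +
      ((4 * C γ + 2) * (1 - v ^ 2) * K1 + (C γ ^ 2 + C γ) * (2 * i + 1) * K) * hi2
  have hP : 4 * (i * (1 - l) * (1 - i * (1 - l))) * v ^ 2 = v ^ 2 - 1 := by
    linear_combination v ^ 2 * (2 * (1 - l) - (1 - l) ^ 2 * (2 * i + 1)) * hi2 -
      (l * v + 1) * hlv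
  linear_combination
    E * ((C γ ^ 2 + C γ) * K - (4 * C γ + 6) * v ^ 2 * K1 + 4 * v ^ 4 * K2) * hP +
    C c * E * (2 * C γ * K - 4 * v ^ 2 * K1) * hlv - E * v ^ 2 * ode' -
    C c * (1 - l) * E * (2 * C γ * v * K - 4 * v ^ 3 * K1) * hi2

/-- Gauss's quadratic transformation. -/
theorem hyp2F1_quadratic (γ : ℂ) {c : ℂ} (hc : ∀ k : ℕ, c + k ≠ 0) {Z v : ℂ⟦X⟧}
    (hZ : constantCoeff Z = 0) (hv : (1 - 2 * Z) * v = 1) :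
    hyp2F1 γ (2 * c - 1 - γ) c Z =
      cpow (1 - 2 * Z) (-γ) * hyp2F1 (γ / 2) (γ / 2 + 1 / 2) c (1 - v ^ 2) := by
  have hs := hasSubst_of_constantCoeff hZ
  have hl1 : constantCoeff (1 - C 2 * X : ℂ⟦X⟧) = 1 := by simp
  have hl : ((1 - C 2 * X : ℂ⟦X⟧).subst Z : ℂ⟦X⟧) = 1 - 2 * Z := by
    rw [subst_sub hs, subst_mul hs, subst_one', subst_X hs, subst_C', map_ofNat]
  have hw : (((1 - C 2 * X : ℂ⟦X⟧)⁻¹).subst Z : ℂ⟦X⟧) = v := by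
    have h := congrArg (fun F : ℂ⟦X⟧ => (F.subst Z : ℂ⟦X⟧))
      (PowerSeries.mul_inv_cancel (1 - C 2 * X : ℂ⟦X⟧) (by simp))
    simp only [subst_mul hs, hl, subst_one'] at h
    linear_combination v * h - ((1 - C 2 * X : ℂ⟦X⟧)⁻¹).subst Z * hv
  have h := congrArg (fun F : ℂ⟦X⟧ => (F.subst Z : ℂ⟦X⟧)) (hypSeries_quadratic γ hc)
  simp only [subst_mul hs, cpow_subst hl1 hZ, hl] at h
  rw [subst_comp_subst_apply (hasSubst_of_constantCoeff (by simp)) hs, subst_sub hs, subst_pow hs,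
    hw, subst_one'] at h
  exact h

/-! ### Homogeneous Gegenbauer polynomials and their differential equation in `z`, `w` -/

section homogeneousGegenbauer

variable {A : Type*} [CommRing A] [Algebra ℂ A]

/-- The coefficient of `s ^ n` in `(1 - 2 p s + e s ^ 2) ^ (-lam)`, by its three-term recurrence. -/
noncomputable def hgeg (lam : ℂ) (p e : A) : ℕ → A
  | 0 => 1
  | 1 => (2 * lam) • p
  | n + 2 => ((n : ℂ) + 2)⁻¹ • ((2 * (n + 1 + lam)) • (p * hgeg lam p e (n + 1)) -
      (n + 2 * lam) • (e * hgeg lam p e n))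

theorem hgeg_succ_succ (lam : ℂ) (p e : A) (n : ℕ) :
    ((n : ℂ) + 2) • hgeg lam p e (n + 2) = (2 * (n + 1 + lam)) • (p * hgeg lam p e (n + 1)) -
      (n + 2 * lam) • (e * hgeg lam p e n) := by
  have h : (n : ℂ) + 2 ≠ 0 := by exact_mod_cast (n + 1).succ_ne_zero
  rw [hgeg, smul_smul, mul_inv_cancel₀ h, one_smul]

/-- The three-term recurrence determines the coefficients. -/
theorem eq_hgeg {lam : ℂ} {p e : A} {y : ℕ → A} (h0 : y 0 = 1) (h1 : y 1 = (2 * lam) • p)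
    (h : ∀ n : ℕ, ((n : ℂ) + 2) • y (n + 2) = (2 * (n + 1 + lam)) • (p * y (n + 1)) -
      (n + 2 * lam) • (e * y n)) (n : ℕ) : y n = hgeg lam p e n := by
  induction n using Nat.strong_induction_on with
  | _ n ih =>
    match n with
    | 0 => simpa [hgeg] using h0
    | 1 => simpa [hgeg] using h1
    | n + 2 =>
      have hn : (n : ℂ) + 2 ≠ 0 := by exact_mod_cast (n + 1).succ_ne_zero
      have h2 := h n
      rw [ih n (by omega), ih (n + 1) (by omega), ← hgeg_succ_succ] at h2
      exact (smul_right_injective A hn) h2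

theorem map_hgeg {B : Type*} [CommRing B] [Algebra ℂ B] (φ : A →ₐ[ℂ] B) (lam : ℂ) (p e : A)
    (n : ℕ) : φ (hgeg lam p e n) = hgeg lam (φ p) (φ e) n := by
  refine eq_hgeg (y := fun n => φ (hgeg lam p e n)) ?_ ?_ ?_ n
  · simp [hgeg]
  · simp [hgeg]
  · intro n
    rw [← map_smul, hgeg_succ_succ]
    simp

/-- For `e = p²` the quadratic is `(1 - zs)²`, so this is the binomial series of `(1 - zs)^(-2λ)`.
It supplies the initial values at `w = 0`. -/
theorem hgeg_sq (lam : ℂ) (z : A) (n : ℕ) :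
    hgeg lam z (z ^ 2) n =
      ((ascPochhammer ℂ n).eval (2 * lam) / (n.factorial : ℂ)) • z ^ n := by
  symm
  refine eq_hgeg (y := fun n => ((ascPochhammer ℂ n).eval (2 * lam) / (n.factorial : ℂ)) • z ^ n)
    ?_ ?_ ?_ n
  · simp
  · simp
  · intro n
    have h3 : (Nat.factorial n : ℂ) ≠ 0 := by exact_mod_cast n.factorial_ne_zero
    have h4 : (n + 1 : ℂ) ≠ 0 := by exact_mod_cast n.succ_ne_zero
    have h5 : (n + 2 : ℂ) ≠ 0 := by exact_mod_cast (n + 1).succ_ne_zero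
    have e1 : z * z ^ (n + 1) = z ^ (n + 2) := by ring
    have e2 : z ^ 2 * z ^ n = z ^ (n + 2) := by ring
    simp only [mul_smul_comm, e1, e2, smul_smul, ← sub_smul]
    congr 1
    simp only [ascPochhammer_succ_eval, Nat.factorial_succ]
    push_cast
    have h6 : (n + 1 + 1 : ℂ) ≠ 0 := by rw [add_assoc, one_add_one_eq_two]; exact h5
    field_simp
    ring

/-- The generating series of `hgeg`. -/
noncomputable def hgegSeries (lam : ℂ) (p e : A) : A⟦X⟧ := PowerSeries.mk (hgeg lam p e)

theorem hgegSeries_ode (lam : ℂ) (p e : A) :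
    (1 - C (2 * p) * X + C e * X ^ 2) * d⁄dX A (hgegSeries lam p e) =
      C (algebraMap ℂ A lam) * (C (2 * p) - C (2 * e) * X) * hgegSeries lam p e := by
  have h : ∀ F G : A⟦X⟧, (1 - C (2 * p) * X + C e * X ^ 2) * F =
      C (algebraMap ℂ A lam) * (C (2 * p) - C (2 * e) * X) * G ↔ F - C (2 * p) * (X * F) +
      C e * (X * (X * F)) = C (algebraMap ℂ A lam * (2 * p)) * G -
      C (algebraMap ℂ A lam * (2 * e)) * (X * G) := by
    intro F G
    rw [map_mul C (algebraMap ℂ A lam) (2 * p), map_mul C (algebraMap ℂ A lam) (2 * e)]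
    constructor <;> intro h <;> linear_combination h
  rw [h]
  ext n
  simp only [map_sub, map_add, coeff_C_mul]
  rcases n with _ | _ | n
  · simp [coeff_derivative, hgegSeries, hgeg, Algebra.smul_def, map_ofNat (algebraMap ℂ A) 2]; ring
  · have h1 := hgeg_succ_succ lam p e 0
    simp only [coeff_succ_X_mul, coeff_derivative, coeff_zero_X_mul, hgegSeries, coeff_mk]
    simp only [hgeg, Algebra.smul_def, map_mul, map_add, map_ofNat, map_natCast, map_one] at h1 ⊢
    push_cast at h1 ⊢
    linear_combination h1
  · have h1 := hgeg_succ_succ lam p e (n + 1)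
    simp only [coeff_succ_X_mul, coeff_derivative, hgegSeries, coeff_mk]
    simp only [Algebra.smul_def, map_mul, map_add, map_ofNat, map_natCast, map_one] at h1
    push_cast at h1 ⊢
    linear_combination h1

/-- A derivation of `A` acting on the coefficients of power series. -/
noncomputable def coeffDeriv (δ : Derivation ℂ A A) (F : A⟦X⟧) : A⟦X⟧ := PowerSeries.mk fun n => δ (coeff n F)

theorem coeffDeriv_add (δ : Derivation ℂ A A) (F G : A⟦X⟧) :
    coeffDeriv δ (F + G) = coeffDeriv δ F + coeffDeriv δ G := by
  ext n; simp [coeffDeriv]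

theorem coeffDeriv_sub (δ : Derivation ℂ A A) (F G : A⟦X⟧) :
    coeffDeriv δ (F - G) = coeffDeriv δ F - coeffDeriv δ G := by
  ext n; simp [coeffDeriv]

theorem coeffDeriv_mul (δ : Derivation ℂ A A) (F G : A⟦X⟧) :
    coeffDeriv δ (F * G) = F * coeffDeriv δ G + G * coeffDeriv δ F := by
  ext n
  rw [mul_comm G]
  simp only [coeffDeriv, coeff_mk, coeff_mul, map_add, map_sum, Derivation.leibniz, smul_eq_mul,
    Finset.sum_add_distrib]
  congr 1
  exact Finset.sum_congr rfl fun _ _ => mul_comm _ _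

theorem coeffDeriv_C (δ : Derivation ℂ A A) (a : A) : coeffDeriv δ (C a) = C (δ a) := by
  ext n; simp only [coeffDeriv, coeff_mk, coeff_C]; split_ifs <;> simp

theorem coeffDeriv_X (δ : Derivation ℂ A A) : coeffDeriv δ (X : A⟦X⟧) = 0 := by
  ext n; simp only [coeffDeriv, coeff_mk, coeff_X]; split_ifs <;> simp

theorem derivative_coeffDeriv (δ : Derivation ℂ A A) (F : A⟦X⟧) :
    d⁄dX A (coeffDeriv δ F) = coeffDeriv δ (d⁄dX A F) := by
  ext n
  simp only [coeffDeriv, coeff_mk, coeff_derivative, Derivation.leibniz]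
  simp [mul_comm, -map_add, (by simp : δ ((n : A) + 1) = 0)]

/-- This is the chain rule for `δ (D^(-λ))`, multiplied by `D = 1 - 2ps + es²`. Powers are not
available over `A`, so it is deduced from the equation in `s`. -/
theorem coeffDeriv_hgegSeries (δ : Derivation ℂ A A) (lam : ℂ) (p e : A) :
    (1 - C (2 * p) * X + C e * X ^ 2) * coeffDeriv δ (hgegSeries lam p e) =
      C (algebraMap ℂ A lam) * (C (2 * δ p) * X - C (δ e) * X ^ 2) * hgegSeries lam p e := by
  let _ : Algebra ℚ A := Algebra.compHom A (algebraMap ℚ ℂ)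
  set F := hgegSeries lam p e
  set D : A⟦X⟧ := 1 - C (2 * p) * X + C e * X ^ 2 with hD
  have hu : IsUnit D := isUnit_iff_constantCoeff.2 (by simp [hD])
  rw [← sub_eq_zero]
  have ode := hgegSeries_ode lam p e
  have h2 : (C 2 : A⟦X⟧) = 2 := map_ofNat C 2
  have d2 : δ 2 = 0 := by simpa using δ.map_natCast 2
  have d1 : δ 1 = 0 := δ.map_one_eq_zero
  have ode' := congrArg (coeffDeriv δ) ode
  have hC1 : coeffDeriv δ (1 : A⟦X⟧) = 0 := by
    have := coeffDeriv_C δ (1 : A); simpa using this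
  have hC2 : coeffDeriv δ (2 : A⟦X⟧) = 0 := by rw [← h2, coeffDeriv_C, d2, map_zero]
  have hD2 : d⁄dX A (2 : A⟦X⟧) = 0 := by rw [← h2, derivative_C]
  simp only [coeffDeriv_mul, coeffDeriv_add, coeffDeriv_sub, coeffDeriv_C, coeffDeriv_X, hC1, hC2,
    pow_two, Derivation.map_algebraMap, map_zero, mul_zero, ← derivative_coeffDeriv, map_mul,
    h2] at ode'
  -- The difference of the two sides satisfies the first-order equation of `D^(1-λ)` and has no
  -- constant term.
  refine eq_zero_of_first_order hu
    (g := (C (algebraMap ℂ A lam) - 1) * (C (2 * p) - C (2 * e) * X)) ?_ ?_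
  · rw [hD] at *
    simp only [map_sub, map_add, Derivation.leibniz, derivative_C, derivative_X, derivative_one,
      pow_two, smul_eq_mul, map_mul, h2, hD2] at ode ode' ⊢
    linear_combination (1 - 2 * C p * X + C e * (X * X)) * ode' +
      (C (algebraMap ℂ A lam) - 1) * (C (δ e) * (X * X) - 2 * C (δ p) * X) * ode
  · simp only [hD, map_sub, map_mul, map_add, constantCoeff_X, map_pow]
    simp [coeffDeriv, hgegSeries, hgeg, F]

theorem coeffDeriv_coeffDeriv_hgegSeries (δ : Derivation ℂ A A) (lam : ℂ) (p e : A) :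
    (1 - C (2 * p) * X + C e * X ^ 2) ^ 2 * coeffDeriv δ (coeffDeriv δ (hgegSeries lam p e)) =
      C (algebraMap ℂ A lam) * ((C (algebraMap ℂ A lam) + 1) *
        (C (2 * δ p) * X - C (δ e) * X ^ 2) ^ 2 + (1 - C (2 * p) * X + C e * X ^ 2) *
        (C (2 * δ (δ p)) * X - C (δ (δ e)) * X ^ 2)) * hgegSeries lam p e := by
  have h2 : (C 2 : A⟦X⟧) = 2 := map_ofNat C 2
  have d2 : δ 2 = 0 := by simpa using δ.map_natCast 2
  have hC1 : coeffDeriv δ (1 : A⟦X⟧) = 0 := by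
    have := coeffDeriv_C δ (1 : A); simpa using this
  have hC2 : coeffDeriv δ (2 : A⟦X⟧) = 0 := by rw [← h2, coeffDeriv_C, d2, map_zero]
  have h := coeffDeriv_hgegSeries δ lam p e
  have h' := congrArg (coeffDeriv δ) h
  simp only [coeffDeriv_mul, coeffDeriv_add, coeffDeriv_sub, coeffDeriv_C, coeffDeriv_X, hC1, hC2,
    pow_two, Derivation.map_algebraMap, map_zero, mul_zero, map_mul, h2] at h h' ⊢
  linear_combination (1 - 2 * C p * X + C e * (X * X)) * h' +
    (C (algebraMap ℂ A lam) + 1) * (2 * C (δ p) * X - C (δ e) * (X * X)) * h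

/-- In the coordinates `p = z + w - 2 z w`, `e = (w - z) ^ 2`, the generating series is annihilated
by the difference of the hypergeometric operators in `z` and `w`. -/
theorem hgegSeries_pde (lam : ℂ) {δ ε : Derivation ℂ A A} {z w : A} (hδz : δ z = 1) (hδw : δ w = 0)
    (hεz : ε z = 0) (hεw : ε w = 1) {p e : A} (hp : p = z + w - 2 * z * w)
    (he : e = (w - z) ^ 2) :
    C (z * (1 - z)) * coeffDeriv δ (coeffDeriv δ (hgegSeries lam p e)) +
      C (algebraMap ℂ A (lam + 1 / 2) * (1 - 2 * z)) * coeffDeriv δ (hgegSeries lam p e) =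
    C (w * (1 - w)) * coeffDeriv ε (coeffDeriv ε (hgegSeries lam p e)) +
      C (algebraMap ℂ A (lam + 1 / 2) * (1 - 2 * w)) * coeffDeriv ε (hgegSeries lam p e) := by
  have h2 : (C 2 : A⟦X⟧) = 2 := map_ofNat C 2
  have d2 : ∀ d : Derivation ℂ A A, d 2 = 0 := fun d => by simpa using d.map_natCast 2
  have p0 : δ p = 1 - 2 * w := by
    rw [hp]; simp [Derivation.leibniz, d2, hδz, hδw]; ring
  have p1 : ε p = 1 - 2 * z := by
    rw [hp]; simp [Derivation.leibniz, d2, hεz, hεw]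
  have e0 : δ e = 2 * (z - w) := by
    rw [he, pow_two]; simp [Derivation.leibniz, hδz, hδw]; ring
  have e1 : ε e = 2 * (w - z) := by
    rw [he, pow_two]; simp [Derivation.leibniz, hεz, hεw]; ring
  have p00 : δ (δ p) = 0 := by rw [p0]; simp [Derivation.leibniz, d2, hδw]
  have p11 : ε (ε p) = 0 := by rw [p1]; simp [Derivation.leibniz, d2, hεz]
  have e00 : δ (δ e) = 2 := by rw [e0]; simp [Derivation.leibniz, d2, hδz, hδw]
  have e11 : ε (ε e) = 2 := by rw [e1]; simp [Derivation.leibniz, d2, hεz, hεw]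
  have h0 := coeffDeriv_hgegSeries δ lam p e
  have h1 := coeffDeriv_hgegSeries ε lam p e
  have h00 := coeffDeriv_coeffDeriv_hgegSeries δ lam p e
  have h11 := coeffDeriv_coeffDeriv_hgegSeries ε lam p e
  have hu : IsUnit ((1 - C (2 * p) * X + C e * X ^ 2 : A⟦X⟧) ^ 2) :=
    (isUnit_iff_constantCoeff.2 (by simp)).pow 2
  -- After multiplication by `D²` every derivative is a polynomial multiple of the series itself.
  apply hu.mul_left_cancel
  rw [p00, e00, p0, e0] at h00
  rw [p11, e11, p1, e1] at h11
  rw [p0, e0] at h0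
  rw [p1, e1] at h1
  obtain ⟨h, hh⟩ : ∃ h : A⟦X⟧, h = C (algebraMap ℂ A (1 / 2)) := ⟨_, rfl⟩
  have hh2 : 2 * h = 1 := by
    rw [hh, ← h2, ← map_ofNat (algebraMap ℂ A) 2, ← map_mul, ← map_mul]; norm_num
  generalize coeffDeriv δ (coeffDeriv δ (hgegSeries lam p e)) = F00 at *
  generalize coeffDeriv ε (coeffDeriv ε (hgegSeries lam p e)) = F11 at *
  generalize coeffDeriv δ (hgegSeries lam p e) = F0 at *
  generalize coeffDeriv ε (hgegSeries lam p e) = F1 at *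
  generalize hgegSeries lam p e = F at *
  subst hp he
  simp only [map_add, map_sub, map_mul, map_one, map_zero, map_pow, h2, ← hh] at h0 h1 h00 h11 ⊢
  generalize C (algebraMap ℂ A lam) = l at *
  generalize C z = Z at *
  generalize C w = W at *
  linear_combination Z * (1 - Z) * h00 - W * (1 - W) * h11 +
    (l + h) * (1 - 2 * (Z + W - 2 * Z * W) * X + (W - Z) ^ 2 * X ^ 2) *
      ((1 - 2 * Z) * h0 - (1 - 2 * W) * h1) +
    l * F * (1 - 2 * (Z + W - 2 * Z * W) * X + (W - Z) ^ 2 * X ^ 2) * X ^ 2 * 2 * (W - Z) *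
      (1 - Z - W) * hh2

end homogeneousGegenbauer

/-! ### Coefficients of substituted series in one and two variables -/

theorem coeff_eq_zero_of_X_pow_dvd {F : ℂ⟦X⟧} {m N : ℕ} (h : (X : ℂ⟦X⟧) ^ m ∣ F) (hN : N < m) :
    coeff N F = 0 := X_pow_dvd_iff.1 h N hN

theorem X_pow_dvd_pow {z : ℂ⟦X⟧} (hz : constantCoeff z = 0) (i : ℕ) : (X : ℂ⟦X⟧) ^ i ∣ z ^ i :=
  pow_dvd_pow_of_dvd (X_dvd_iff.2 hz) i

theorem X_pow_dvd_mul_pow_mul_pow {z w : ℂ⟦X⟧} (hz : constantCoeff z = 0)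
    (hw : constantCoeff w = 0) (E : ℂ⟦X⟧) (i j : ℕ) : (X : ℂ⟦X⟧) ^ (i + j) ∣ E * z ^ i * w ^ j := by
  rw [pow_add, mul_assoc]
  exact Dvd.dvd.mul_left (mul_dvd_mul (X_pow_dvd_pow hz i) (X_pow_dvd_pow hw j)) E

theorem coeff_mul_subst (E F : ℂ⟦X⟧) {g : ℂ⟦X⟧} (hg : constantCoeff g = 0) (N : ℕ) :
    coeff N (E * (F.subst g : ℂ⟦X⟧)) =
      ∑ i ∈ Finset.range (N + 1), coeff i F * coeff N (E * g ^ i) := by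
  have hs := hasSubst_of_constantCoeff hg
  have h := eq_X_pow_mul_shift_add_trunc (N + 1) F
  have h1 : coeff N (E * (g ^ (N + 1) * ((PowerSeries.mk fun i => coeff (i + (N + 1)) F).subst g))) =
      0 := by
    apply coeff_eq_zero_of_X_pow_dvd (m := N + 1) _ (by omega)
    exact Dvd.dvd.mul_left (Dvd.dvd.mul_right (X_pow_dvd_pow hg _) _) _
  conv_lhs => rw [h]
  rw [subst_add hs, subst_mul hs, subst_pow hs, subst_X hs, mul_add, map_add, h1, zero_add,
    subst_coe hs, trunc_apply, map_sum, Finset.mul_sum, map_sum, Nat.Ico_zero_eq_range]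
  refine Finset.sum_congr rfl fun i _ => ?_
  rw [Polynomial.aeval_monomial, ← mul_assoc, mul_comm E, mul_assoc]
  exact coeff_C_mul N _ (coeff i F)

/-- The coefficient of `z ^ i * w ^ j` in a polynomial in two variables. -/
noncomputable def bicoeff (i j : ℕ) (Q : MvPolynomial (Fin 2) ℂ) : ℂ :=
  Q.coeff (Finsupp.single 0 i + Finsupp.single 1 j)

theorem single_add_single_inj {i j : ℕ} {d : Fin 2 →₀ ℕ} :
    d = Finsupp.single 0 i + Finsupp.single 1 j ↔ d 0 = i ∧ d 1 = j := by
  constructor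
  · rintro rfl; simp
  · rintro ⟨h0, h1⟩
    ext k
    fin_cases k <;> simp [h0, h1]

theorem bicoeff_add (i j : ℕ) (P Q : MvPolynomial (Fin 2) ℂ) :
    bicoeff i j (P + Q) = bicoeff i j P + bicoeff i j Q := MvPolynomial.coeff_add _ _ _

theorem bicoeff_sub (i j : ℕ) (P Q : MvPolynomial (Fin 2) ℂ) :
    bicoeff i j (P - Q) = bicoeff i j P - bicoeff i j Q := MvPolynomial.coeff_sub _ _ _ _

theorem bicoeff_C_mul (i j : ℕ) (a : ℂ) (Q : MvPolynomial (Fin 2) ℂ) :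
    bicoeff i j (MvPolynomial.C a * Q) = a * bicoeff i j Q := MvPolynomial.coeff_C_mul _ _ _

theorem bicoeff_X_zero_mul (i j : ℕ) (Q : MvPolynomial (Fin 2) ℂ) :
    bicoeff i j (MvPolynomial.X 0 * Q) = if i = 0 then 0 else bicoeff (i - 1) j Q := by
  rw [bicoeff, MvPolynomial.coeff_X_mul']
  rcases i with _ | i
  · simp
  · simp only [bicoeff]
    rw [if_pos (by simp), if_neg (by simp)]
    congr 1
    ext k; fin_cases k <;> simp

theorem bicoeff_X_one_mul (i j : ℕ) (Q : MvPolynomial (Fin 2) ℂ) :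
    bicoeff i j (MvPolynomial.X 1 * Q) = if j = 0 then 0 else bicoeff i (j - 1) Q := by
  rw [bicoeff, MvPolynomial.coeff_X_mul']
  rcases j with _ | j
  · simp
  · simp only [bicoeff]
    rw [if_pos (by simp), if_neg (by simp)]
    congr 1
    ext k; fin_cases k <;> simp

theorem bicoeff_pderiv_zero (i j : ℕ) (Q : MvPolynomial (Fin 2) ℂ) :
    bicoeff i j (MvPolynomial.pderiv 0 Q) = (i + 1) * bicoeff (i + 1) j Q := by
  simp only [bicoeff]
  rw [MvPolynomial.coeff_pderiv, mul_comm]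
  congr 1
  · simp
  · congr 1; ext k; fin_cases k <;> simp

theorem bicoeff_pderiv_one (i j : ℕ) (Q : MvPolynomial (Fin 2) ℂ) :
    bicoeff i j (MvPolynomial.pderiv 1 Q) = (j + 1) * bicoeff i (j + 1) Q := by
  simp only [bicoeff]
  rw [MvPolynomial.coeff_pderiv, mul_comm]
  congr 1
  · simp
  · congr 1; ext k; fin_cases k <;> simp

theorem bicoeff_monomial (i j : ℕ) (d : Fin 2 →₀ ℕ) (a : ℂ) :
    bicoeff i j (MvPolynomial.monomial d a) = if d 0 = i ∧ d 1 = j then a else 0 := by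
  rw [bicoeff, MvPolynomial.coeff_monomial]
  simp only [single_add_single_inj]

/-- A polynomial in two variables evaluated at power series without constant term. -/
theorem coeff_mul_aeval (E : ℂ⟦X⟧) {z w : ℂ⟦X⟧} (hz : constantCoeff z = 0)
    (hw : constantCoeff w = 0) (N : ℕ) (Q : MvPolynomial (Fin 2) ℂ) :
    coeff N (E * MvPolynomial.aeval ![z, w] Q) =
      ∑ i ∈ Finset.range (N + 1), ∑ j ∈ Finset.range (N + 1),
        bicoeff i j Q * coeff N (E * z ^ i * w ^ j) := by
  induction Q using MvPolynomial.induction_on' with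
  | monomial d a =>
    have h : E * MvPolynomial.aeval ![z, w] (MvPolynomial.monomial d a) =
        C a * (E * z ^ d 0 * w ^ d 1) := by
      rw [MvPolynomial.aeval_monomial, Finsupp.prod_fintype _ _ (by simp), Fin.prod_univ_two]
      simp only [Matrix.cons_val_zero, Matrix.cons_val_one]
      have : algebraMap ℂ ℂ⟦X⟧ a = C a := rfl
      rw [this]; ring
    rw [h, coeff_C_mul]
    by_cases hd : d 0 < N + 1 ∧ d 1 < N + 1
    · rw [Finset.sum_eq_single (d 0), Finset.sum_eq_single (d 1)]
      · rw [bicoeff_monomial, if_pos ⟨rfl, rfl⟩]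
      · intro j _ hj
        rw [bicoeff_monomial, if_neg (fun h => hj h.2.symm), zero_mul]
      · intro h; exact absurd (Finset.mem_range.2 hd.2) h
      · intro i _ hi
        refine Finset.sum_eq_zero fun j _ => ?_
        rw [bicoeff_monomial, if_neg (fun h => hi h.1.symm), zero_mul]
      · intro h; exact absurd (Finset.mem_range.2 hd.1) h
    -- An exponent above `N` contributes nothing to the coefficient of `t^N`, since `t` divides `z`
    -- and `w`.
    · rw [coeff_eq_zero_of_X_pow_dvd (X_pow_dvd_mul_pow_mul_pow hz hw E _ _) (by omega), mul_zero]
      symm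
      refine Finset.sum_eq_zero fun i hi => Finset.sum_eq_zero fun j hj => ?_
      rw [Finset.mem_range] at hi hj
      rw [bicoeff_monomial, if_neg (by omega), zero_mul]
  | add P Q hP hQ =>
    rw [map_add, mul_add, map_add, hP, hQ]
    simp only [bicoeff_add, add_mul, Finset.sum_add_distrib]

/-! ### Brafman's product formula -/

/-- The polynomial in `z`, `w` given by the `n`-th coefficient of
`(1 - 2 (z + w - 2 z w) s + (w - z) ^ 2 s ^ 2) ^ (-lam)`. -/
noncomputable def bigeg (lam : ℂ) (n : ℕ) : MvPolynomial (Fin 2) ℂ :=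
  hgeg lam (MvPolynomial.X 0 + MvPolynomial.X 1 - 2 * MvPolynomial.X 0 * MvPolynomial.X 1)
    ((MvPolynomial.X 1 - MvPolynomial.X 0) ^ 2) n

theorem aeval_bigeg (lam : ℂ) (z w : ℂ⟦X⟧) (n : ℕ) :
    MvPolynomial.aeval ![z, w] (bigeg lam n) = hgeg lam (z + w - 2 * z * w) ((w - z) ^ 2) n := by
  rw [bigeg, map_hgeg]
  simp

open MvPolynomial in
theorem bigeg_pde (lam : ℂ) (n : ℕ) :
    MvPolynomial.X 0 * (1 - MvPolynomial.X 0) * pderiv 0 (pderiv 0 (bigeg lam n)) +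
      MvPolynomial.C (lam + 1 / 2) * (1 - 2 * MvPolynomial.X 0) * pderiv 0 (bigeg lam n) =
    MvPolynomial.X 1 * (1 - MvPolynomial.X 1) * pderiv 1 (pderiv 1 (bigeg lam n)) +
      MvPolynomial.C (lam + 1 / 2) * (1 - 2 * MvPolynomial.X 1) * pderiv 1 (bigeg lam n) := by
  have n01 : (0 : Fin 2) ≠ 1 := by decide
  have h := congrArg (PowerSeries.coeff n) (hgegSeries_pde lam (A := MvPolynomial (Fin 2) ℂ)
    (pderiv_X_self 0) (pderiv_X_of_ne n01.symm) (pderiv_X_of_ne n01) (pderiv_X_self 1) rfl rfl)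
  simpa only [map_add, PowerSeries.coeff_C_mul, coeffDeriv, coeff_mk, hgegSeries,
    MvPolynomial.algebraMap_eq, bigeg] using h

/-- Coefficient of `z^i w^j` in `bigeg_pde`. As `λ + 1/2 + j ≠ 0` in the application, it computes
column `j + 1` from column `j`. -/
theorem bicoeff_bigeg_rec (lam : ℂ) (n i j : ℕ) :
    (i + 1) * (lam + 1 / 2 + i) * bicoeff (i + 1) j (bigeg lam n) -
      i * (i + 2 * lam) * bicoeff i j (bigeg lam n) =
    (j + 1) * (lam + 1 / 2 + j) * bicoeff i (j + 1) (bigeg lam n) -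
      j * (j + 2 * lam) * bicoeff i j (bigeg lam n) := by
  have h := congrArg (bicoeff i j) (bigeg_pde lam n)
  obtain ⟨c, hc⟩ : ∃ c, c = lam + 1 / 2 := ⟨_, rfl⟩
  have hlam : lam = c - 1 / 2 := by rw [hc]; ring
  rw [← hc] at h ⊢
  have h2 : (MvPolynomial.C (2 * c) : MvPolynomial (Fin 2) ℂ) = 2 * MvPolynomial.C c := by
    rw [map_mul, map_ofNat]
  have e : ∀ x f g : MvPolynomial (Fin 2) ℂ, x * (1 - x) * f + MvPolynomial.C c * (1 - 2 * x) * g =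
      x * f - x * (x * f) + MvPolynomial.C c * g - MvPolynomial.C (2 * c) * (x * g) := by
    intro x f g; rw [h2]; ring
  rw [e, e] at h
  simp only [bicoeff_add, bicoeff_sub, bicoeff_C_mul, bicoeff_X_zero_mul, bicoeff_X_one_mul,
    bicoeff_pderiv_zero, bicoeff_pderiv_one] at h
  have hlam2 : 2 * lam = 2 * c - 1 := by rw [hlam]; ring
  rw [hlam2]
  rcases i with _ | _ | i <;> rcases j with _ | _ | j <;>
    simp [-mul_eq_mul_left_iff, -mul_eq_mul_right_iff] at h ⊢ <;> linear_combination h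

theorem bicoeff_bigeg_zero (lam : ℂ) (n i : ℕ) :
    bicoeff i 0 (bigeg lam n) =
      if i = n then (ascPochhammer ℂ n).eval (2 * lam) / (n.factorial : ℂ) else 0 := by
  have h := coeff_mul_aeval 1 (z := X) (w := 0) (by simp) (by simp) i (bigeg lam n)
  rw [aeval_bigeg] at h
  have e : hgeg lam (X + 0 - 2 * X * 0 : ℂ⟦X⟧) ((0 - X) ^ 2) n = hgeg lam X (X ^ 2) n := by
    congr 1 <;> ring
  rw [e, hgeg_sq, one_mul, coeff_smul, coeff_X_pow, Finset.sum_eq_single i,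
    Finset.sum_eq_single 0] at h
  · simp only [pow_zero, mul_one, one_mul, coeff_X_pow, if_true] at h
    rw [← h]; split_ifs <;> simp
  · intro j _ hj; simp [hj]
  · simp
  · intro k _ hk
    refine Finset.sum_eq_zero fun j _ => ?_
    rcases j with _ | j
    · simp [coeff_X_pow, hk.symm]
    · simp
  · simp

/-- Both sides satisfy the recurrence `bicoeff_bigeg_rec`, whose coefficients do not involve `n`,
and they agree for `j = 0` by the choice of `a`. A step in `j` may raise `i` by one but keeps `i + j
< M`. -/
theorem sum_bicoeff_bigeg {lam : ℂ} (hc : ∀ k : ℕ, lam + 1 / 2 + k ≠ 0) (γ : ℂ) {a : ℕ → ℂ}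
    (ha : ∀ n, a n * ((ascPochhammer ℂ n).eval (2 * lam) / (n.factorial : ℂ)) =
      coeff n (hypSeries γ (2 * lam - γ) (lam + 1 / 2))) {i j M : ℕ} (hM : i + j < M) :
    ∑ n ∈ Finset.range M, a n * bicoeff i j (bigeg lam n) =
      coeff i (hypSeries γ (2 * lam - γ) (lam + 1 / 2)) *
        coeff j (hypSeries γ (2 * lam - γ) (lam + 1 / 2)) := by
  induction j generalizing i with
  | zero =>
    rw [Finset.sum_eq_single i]
    · rw [bicoeff_bigeg_zero, if_pos rfl, ha]
      simp
    · intro n _ hn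
      rw [bicoeff_bigeg_zero, if_neg hn.symm, mul_zero]
    · intro h; exact absurd (Finset.mem_range.2 (by omega)) h
  | succ j ih =>
    have h1 : (j + 1 : ℂ) * (lam + 1 / 2 + j) ≠ 0 :=
      mul_ne_zero (by exact_mod_cast j.succ_ne_zero) (hc j)
    apply mul_left_cancel₀ h1
    have e : ∀ n, (j + 1 : ℂ) * (lam + 1 / 2 + j) * (a n * bicoeff i (j + 1) (bigeg lam n)) =
        (i + 1) * (lam + 1 / 2 + i) * (a n * bicoeff (i + 1) j (bigeg lam n)) +
        (j * (j + 2 * lam) - i * (i + 2 * lam)) * (a n * bicoeff i j (bigeg lam n)) := by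
      intro n
      linear_combination - a n * bicoeff_bigeg_rec lam n i j
    rw [Finset.mul_sum, Finset.sum_congr rfl fun n _ => e n, Finset.sum_add_distrib,
      ← Finset.mul_sum, ← Finset.mul_sum, ih (by omega), ih (by omega)]
    have hi := coeff_hypSeries_succ γ (2 * lam - γ) hc i
    have hj := coeff_hypSeries_succ γ (2 * lam - γ) hc j
    linear_combination coeff j (hypSeries γ (2 * lam - γ) (lam + 1 / 2)) * hi -
      coeff i (hypSeries γ (2 * lam - γ) (lam + 1 / 2)) * hj

/-- Brafman's generating function, with power series as arguments. -/
theorem coeff_mul_hyp_mul_hyp {lam : ℂ} (hc : ∀ k : ℕ, lam + 1 / 2 + k ≠ 0) (γ : ℂ) {a : ℕ → ℂ}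
    (ha : ∀ n, a n * ((ascPochhammer ℂ n).eval (2 * lam) / (n.factorial : ℂ)) =
      coeff n (hypSeries γ (2 * lam - γ) (lam + 1 / 2))) (E : ℂ⟦X⟧) {z w : ℂ⟦X⟧}
    (hz : constantCoeff z = 0) (hw : constantCoeff w = 0) (N : ℕ) :
    coeff N (E * hyp2F1 γ (2 * lam - γ) (lam + 1 / 2) z *
      hyp2F1 γ (2 * lam - γ) (lam + 1 / 2) w) =
    ∑ n ∈ Finset.range (N + 1), a n *
      coeff N (E * hgeg lam (z + w - 2 * z * w) ((w - z) ^ 2) n) := by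
  have hR : ∀ n ∈ Finset.range (N + 1), a n *
      coeff N (E * hgeg lam (z + w - 2 * z * w) ((w - z) ^ 2) n) =
      ∑ i ∈ Finset.range (N + 1), ∑ j ∈ Finset.range (N + 1),
        a n * bicoeff i j (bigeg lam n) * coeff N (E * z ^ i * w ^ j) := by
    intro n _
    rw [← aeval_bigeg, coeff_mul_aeval E hz hw, Finset.mul_sum]
    refine Finset.sum_congr rfl fun i _ => ?_
    rw [Finset.mul_sum]
    exact Finset.sum_congr rfl fun j _ => (mul_assoc _ _ _).symm
  rw [Finset.sum_congr rfl hR, Finset.sum_comm]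
  change coeff N (E * (hypSeries γ (2 * lam - γ) (lam + 1 / 2)).subst z *
    (hypSeries γ (2 * lam - γ) (lam + 1 / 2)).subst w) = _
  rw [mul_right_comm, coeff_mul_subst _ _ hz]
  refine Finset.sum_congr rfl fun i _ => ?_
  rw [mul_right_comm, coeff_mul_subst _ _ hw, Finset.mul_sum, Finset.sum_comm]
  refine Finset.sum_congr rfl fun j _ => ?_
  rw [← Finset.sum_mul]
  by_cases h : i + j < N + 1
  · rw [sum_bicoeff_bigeg hc γ ha h]
    ring
  · rw [coeff_eq_zero_of_X_pow_dvd (X_pow_dvd_mul_pow_mul_pow hz hw E i j) (by omega)]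
    simp

/-! ### Divided derivatives and the Taylor shift -/

@[simp]
theorem constantCoeff_quad (x : ℂ) : constantCoeff (quad x) = 1 := by simp [quad]

theorem derivative_quad (x : ℂ) : d⁄dX ℂ (quad x) = 2 * (X - C x) := by
  have h2 : d⁄dX ℂ (2 : ℂ⟦X⟧) = 0 := by rw [← map_ofNat C 2, derivative_C]
  simp [quad, map_ofNat C 2, h2]
  ring

/-- The `n`-th divided derivative of a power series. -/
noncomputable def dividedDeriv (n : ℕ) (G : ℂ⟦X⟧) : ℂ⟦X⟧ :=
  PowerSeries.mk fun k => ((k + n).choose n : ℂ) * coeff (k + n) G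

theorem dividedDeriv_zero (G : ℂ⟦X⟧) : dividedDeriv 0 G = G := by
  ext k; simp [dividedDeriv]

theorem derivative_dividedDeriv (n : ℕ) (G : ℂ⟦X⟧) :
    d⁄dX ℂ (dividedDeriv n G) = (n + 1) * dividedDeriv (n + 1) G := by
  have e : ((n : ℂ⟦X⟧) + 1) = C (n + 1 : ℂ) := by simp
  ext k
  rw [e, coeff_C_mul, coeff_derivative, dividedDeriv, dividedDeriv, coeff_mk, coeff_mk,
    show k + 1 + n = k + (n + 1) by ring]
  have h := Nat.choose_succ_right_eq (k + (n + 1)) n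
  rw [show k + (n + 1) - n = k + 1 by omega] at h
  have h' : ((k + (n + 1)).choose (n + 1) : ℂ) * (n + 1) = (k + (n + 1)).choose n * (k + 1) := by
    exact_mod_cast h
  linear_combination -coeff (k + (n + 1)) G * h'

theorem quad_mul_dividedDeriv_one (lam x : ℂ) :
    quad x * dividedDeriv 1 (cpow (quad x) (-lam)) +
      2 * C lam * (X - C x) * cpow (quad x) (-lam) = 0 := by
  have h := derivative_cpow (constantCoeff_quad x) (-lam)
  have h1 := derivative_dividedDeriv 0 (cpow (quad x) (-lam))
  rw [dividedDeriv_zero] at h1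
  rw [h1, derivative_quad, map_neg] at h
  push_cast at h
  linear_combination h

/-- Repeated differentiation of the first-order equation for `G = q^(-λ)`; each differentiation
produces a common factor `n + 2`, which is cancelled. The result is the Gegenbauer recurrence for
the Taylor coefficients. -/
theorem quad_mul_dividedDeriv (lam x : ℂ) (n : ℕ) :
    ((n : ℂ⟦X⟧) + 2) * (quad x * dividedDeriv (n + 2) (cpow (quad x) (-lam))) +
      2 * ((n : ℂ⟦X⟧) + 1 + C lam) * ((X - C x) * dividedDeriv (n + 1) (cpow (quad x) (-lam))) +
      ((n : ℂ⟦X⟧) + 2 * C lam) * dividedDeriv n (cpow (quad x) (-lam)) = 0 := by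
  set G := cpow (quad x) (-lam) with hG
  have h2 : d⁄dX ℂ (2 : ℂ⟦X⟧) = 0 := by rw [← map_ofNat C 2, derivative_C]
  have hn : ∀ n : ℕ, d⁄dX ℂ (n : ℂ⟦X⟧) = 0 := fun n => by rw [← map_natCast C n, derivative_C]
  induction n with
  | zero =>
    have h := congrArg (d⁄dX ℂ) (quad_mul_dividedDeriv_one lam x)
    have h1 := derivative_dividedDeriv 0 G
    rw [dividedDeriv_zero] at h1 ⊢
    simp only [← hG, map_add, map_sub, Derivation.leibniz, derivative_dividedDeriv, derivative_quad,
      derivative_C, derivative_X, smul_eq_mul, h1, h2, map_zero] at h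
    push_cast at h ⊢
    linear_combination h
  | succ n ih =>
    have h := congrArg (d⁄dX ℂ) ih
    simp only [map_add, map_sub, Derivation.leibniz, derivative_dividedDeriv, derivative_quad,
      derivative_C, derivative_X, smul_eq_mul, h2, hn, derivative_one, map_zero] at h
    have h3 : (n + 2 : ℂ⟦X⟧) ≠ 0 := fun h0 => by
      have := congrArg constantCoeff h0
      simp only [map_add, map_natCast, map_ofNat, map_zero] at this
      exact (n + 1).succ_ne_zero (by exact_mod_cast this)
    apply mul_left_cancel₀ h3
    push_cast at h ⊢
    linear_combination h

/-- Taylor's formula for `(1 - 2 x t + t ^ 2) ^ (-lam)`: its divided derivatives are Gegenbauer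
polynomials with shifted arguments. -/
theorem cpow_quad_mul_dividedDeriv (lam x u : ℂ) {v : ℂ⟦X⟧} (hv : quad x * v = 1) (n : ℕ) :
    cpow (quad x) lam * ((C (-u) * X) ^ n * dividedDeriv n (cpow (quad x) (-lam))) =
      hgeg lam (C u * X * (X - C x) * v) ((C u * X) ^ 2 * v) n := by
  refine eq_hgeg (y := fun n => cpow (quad x) lam *
    ((C (-u) * X) ^ n * dividedDeriv n (cpow (quad x) (-lam)))) ?_ ?_ (fun n => ?_) n
  · simp only [pow_zero, one_mul, dividedDeriv_zero]
    exact cpow_mul_cpow_neg (constantCoeff_quad x) lam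
  · have h := quad_mul_dividedDeriv_one lam x
    have h1 := cpow_mul_cpow_neg (constantCoeff_quad x) lam
    simp only [smul_eq_C_mul, map_mul, map_neg, map_ofNat]
    linear_combination -cpow (quad x) lam * C u * X * v * h +
      cpow (quad x) lam * C u * X * dividedDeriv 1 (cpow (quad x) (-lam)) * hv +
      2 * C lam * C u * X * (X - C x) * v * h1
  · have h := quad_mul_dividedDeriv lam x n
    simp only [smul_eq_C_mul, map_mul, map_neg, map_ofNat, map_add, map_natCast, map_one]
    linear_combination cpow (quad x) lam * (-C u * X) ^ n * C u ^ 2 * X ^ 2 * (v * h -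
      (n + 2) * dividedDeriv (n + 2) (cpow (quad x) (-lam)) * hv)

/-- The operator `t^n (d/dt)^n / n!` is diagonal on monomials, with eigenvalue `N choose n` on
`t^N`; this is how the binomials in the `₃F₂` become Taylor terms. -/
theorem coeff_pow_mul_dividedDeriv (u : ℂ) (G : ℂ⟦X⟧) {n N : ℕ} (h : n ≤ N) :
    coeff N ((C u * X) ^ n * dividedDeriv n G) = u ^ n * N.choose n * coeff N G := by
  obtain ⟨k, rfl⟩ := Nat.exists_eq_add_of_le' h
  rw [mul_pow, ← map_pow, mul_assoc, coeff_C_mul, add_comm, coeff_X_pow_mul', if_pos (by omega),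
    dividedDeriv, coeff_mk, Nat.add_sub_cancel_left, add_comm n k, mul_assoc]

theorem hyp3F2_eq_sum (b c d e u : ℂ) (N : ℕ) :
    hyp3F2 (-(N : ℂ)) b c d e u = ∑ k ∈ Finset.range (N + 1),
      (ascPochhammer ℂ k).eval b * (ascPochhammer ℂ k).eval c /
        ((ascPochhammer ℂ k).eval d * (ascPochhammer ℂ k).eval e) *
        ((-u) ^ k * N.choose k) := by
  have hp : ∀ k : ℕ, (ascPochhammer ℂ k).eval (-(N : ℂ)) = (-1) ^ k * (k.factorial * N.choose k) := by
    intro k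
    rw [ascPochhammer_eval_neg_eq_descPochhammer, descPochhammer_eval_eq_descFactorial,
      Nat.descFactorial_eq_factorial_mul_choose]
    push_cast; ring
  rw [hyp3F2, tsum_eq_sum (s := Finset.range (N + 1))]
  · refine Finset.sum_congr rfl fun k _ => ?_
    have h3 : (Nat.factorial k : ℂ) ≠ 0 := by exact_mod_cast k.factorial_ne_zero
    rw [hp, neg_pow u]
    field_simp
  · intro k hk
    rw [hp, Nat.choose_eq_zero_of_lt (by simpa using hk)]
    simp

end BrafmanGegenbauer

/-! ### The two closed forms -/

theorem mainTheorem9 (lam γ x u : ℂ) (hlam : ∀ k : ℕ, lam ≠ -((k : ℂ) / 2)) :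
    PowerSeries.mk (fun n : ℕ =>
        hyp3F2 (-(n : ℂ)) γ (2 * lam - γ) (2 * lam) (lam + 1 / 2) u *
          gegenbauer lam n x) =
      cpow (serR x) (-(2 * lam)) *
        hyp2F1 γ (2 * lam - γ) (lam + 1 / 2)
          ((serR x - serU x u + C u * X) *
            (2 * serR x)⁻¹) *
        hyp2F1 γ (2 * lam - γ) (lam + 1 / 2)
          ((serR x - serU x u - C u * X) *
            (2 * serR x)⁻¹)
    ∧
    PowerSeries.mk (fun n : ℕ =>
        hyp3F2 (-(n : ℂ)) γ (2 * lam - γ) (2 * lam) (lam + 1 / 2) u *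
          gegenbauer lam n x) =
      cpow (serU x u ^ 2 - C (u ^ 2) * X ^ 2) (-γ) *
        cpow (serR x) (2 * γ - 2 * lam) *
        hyp2F1 (γ / 2) (γ / 2 + 1 / 2) (lam + 1 / 2)
          (1 - serR x ^ 2 *
            ((serU x u - C u * X) ^ 2)⁻¹) *
        hyp2F1 (γ / 2) (γ / 2 + 1 / 2) (lam + 1 / 2)
          (1 - serR x ^ 2 *
            ((serU x u + C u * X) ^ 2)⁻¹) := by
  have hc : ∀ k : ℕ, lam + 1 / 2 + k ≠ 0 := by
    intro k h
    apply hlam (2 * k + 1)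
    push_cast
    linear_combination h
  have hd : ∀ k : ℕ, 2 * lam + k ≠ 0 := by
    intro k h
    apply hlam k
    linear_combination h / 2
  have hUq : constantCoeff (1 - C (2 * (1 - u) * x) * X + C ((1 - u) ^ 2) * X ^ 2 : ℂ⟦X⟧) = 1 := by
    simp
  have hR1 : constantCoeff (serR x) = 1 := constantCoeff_cpow (constantCoeff_quad x) _
  have hU1 : constantCoeff (serU x u) = 1 := constantCoeff_cpow hUq _
  have hR2 : serR x ^ 2 = quad x := cpow_half_sq (constantCoeff_quad x)
  have hU2 : serU x u ^ 2 = 1 - C (2 * (1 - u) * x) * X + C ((1 - u) ^ 2) * X ^ 2 :=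
    cpow_half_sq hUq
  have hRpow : cpow (serR x) (-(2 * lam)) = cpow (quad x) (-lam) := by
    rw [serR, cpow_cpow (constantCoeff_quad x)]
    congr 1; ring
  set R := serR x
  set U := serU x u
  have hi : 2 * R * (2 * R)⁻¹ = 1 := PowerSeries.mul_inv_cancel _ (by
    rw [map_mul, hR1, map_ofNat]; norm_num)
  set i := (2 * R)⁻¹
  set z := (R - U + C u * X) * i with hz
  set w := (R - U - C u * X) * i with hw
  have hz0 : constantCoeff z = 0 := by simp [hz, hR1, hU1]
  have hw0 : constantCoeff w = 0 := by simp [hw, hR1, hU1]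
  have hv : quad x * (4 * i ^ 2) = 1 := by
    rw [← hR2]
    linear_combination (2 * R * i + 1) * hi
  -- Equivalently `(1-2z)(1-2w) = (U² - u²t²)/R²`, because `1-2z = (U-ut)/R` and `1-2w = (U+ut)/R`;
  -- here `4 * i ^ 2` is `1/R²`.
  have hp : z + w - 2 * z * w = C u * X * (X - C x) * (4 * i ^ 2) := by
    simp only [map_mul, map_sub, map_one, map_ofNat, map_pow] at hU2
    rw [quad, map_mul, map_ofNat] at hR2
    linear_combination 2 * i ^ 2 * (hR2 - hU2) - 2 * (R - U) * i * hi
  have he : (w - z) ^ 2 = (C u * X) ^ 2 * (4 * i ^ 2) := by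
    rw [hz, hw]; ring
  have first : PowerSeries.mk (fun n : ℕ =>
      hyp3F2 (-(n : ℂ)) γ (2 * lam - γ) (2 * lam) (lam + 1 / 2) u * gegenbauer lam n x) =
      cpow R (-(2 * lam)) * hyp2F1 γ (2 * lam - γ) (lam + 1 / 2) z *
        hyp2F1 γ (2 * lam - γ) (lam + 1 / 2) w := by
    ext N
    rw [coeff_mk, coeff_mul_hyp_mul_hyp hc γ (a := fun k =>
      (ascPochhammer ℂ k).eval γ * (ascPochhammer ℂ k).eval (2 * lam - γ) /
        ((ascPochhammer ℂ k).eval (2 * lam) * (ascPochhammer ℂ k).eval (lam + 1 / 2))) ?_ _ hz0 hw0,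
      hyp3F2_eq_sum, Finset.sum_mul]
    · refine Finset.sum_congr rfl fun n hn => ?_
      rw [Finset.mem_range] at hn
      -- The prefactor `R^(-2λ) = q^(-λ)` cancels the `q^λ` of the Taylor formula.
      rw [hp, he, ← cpow_quad_mul_dividedDeriv lam x u hv, hRpow, ← mul_assoc (cpow _ _),
        mul_comm (cpow _ (-lam)) (cpow _ lam), cpow_mul_cpow_neg (constantCoeff_quad x), one_mul,
        coeff_pow_mul_dividedDeriv _ _ (by omega), gegenbauer, mul_assoc]
    · intro n
      have h1 := ascPochhammer_eval_ne_zero hc n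
      have h2 := ascPochhammer_eval_ne_zero hd n
      have h3 : (Nat.factorial n : ℂ) ≠ 0 := by exact_mod_cast n.factorial_ne_zero
      simp only [hypSeries, coeff_mk, ordinaryHypergeometricCoefficient]
      field_simp
  refine ⟨first, first.trans ?_⟩
  have hcc : 2 * (lam + 1 / 2) - 1 - γ = 2 * lam - γ := by ring
  -- The quadratic transformation with `1 - 2y = (U - st)/R`; the factor `R^(-γ)` clears the
  -- denominator of `(1-2y)^(-γ)`. It is used with `s = u` for `z` and `s = -u` for `w`.
  have key : ∀ (s : ℂ) (y : ℂ⟦X⟧), constantCoeff y = 0 → y = (R - U + C s * X) * i →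
      hyp2F1 γ (2 * lam - γ) (lam + 1 / 2) y * cpow R (-γ) = cpow (U - C s * X) (-γ) *
        hyp2F1 (γ / 2) (γ / 2 + 1 / 2) (lam + 1 / 2) (1 - R ^ 2 * ((U - C s * X) ^ 2)⁻¹) := by
    intro s y hy0 hy
    have hl1 : constantCoeff (1 - 2 * y) = 1 := by simp [hy0]
    have hinv : (U - C s * X) * (U - C s * X)⁻¹ = 1 :=
      PowerSeries.mul_inv_cancel _ (by simp [hU1])
    have hlR : (1 - 2 * y) * R = U - C s * X := by
      rw [hy]
      linear_combination -(R - U + C s * X) * hi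
    have h := hyp2F1_quadratic γ hc (v := R * (U - C s * X)⁻¹) hy0 (by
      rw [← mul_assoc, hlR, hinv])
    have hsq : ((U - C s * X) ^ 2)⁻¹ = ((U - C s * X)⁻¹) ^ 2 := by
      rw [pow_two, PowerSeries.mul_inv_rev, pow_two]
    rw [hcc] at h
    rw [h, hsq, ← mul_pow, mul_right_comm, ← mul_cpow hl1 hR1, hlR]
  have kz := key u z hz0 hz
  have kw := key (-u) w hw0 (by rw [hw, map_neg]; ring)
  have hneg : U - C (-u) * X = U + C u * X := by rw [map_neg]; ring
  rw [hneg] at kw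
  have hprod : cpow (U ^ 2 - C (u ^ 2) * X ^ 2) (-γ) =
      cpow (U - C u * X) (-γ) * cpow (U + C u * X) (-γ) := by
    rw [← mul_cpow (by simp [hU1]) (by simp [hU1])]
    congr 1
    rw [map_pow]; ring
  have hRsplit : cpow R (2 * γ - 2 * lam) = cpow R (-(2 * lam)) * cpow R γ * cpow R γ := by
    rw [← cpow_add hR1, ← cpow_add hR1]
    congr 1; ring
  have hRγ := cpow_mul_cpow_neg hR1 γ
  rw [hprod, hRsplit]
  generalize hyp2F1 (γ / 2) (γ / 2 + 1 / 2) (lam + 1 / 2) (1 - R ^ 2 * ((U - C u * X) ^ 2)⁻¹) = A at *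
  generalize hyp2F1 (γ / 2) (γ / 2 + 1 / 2) (lam + 1 / 2) (1 - R ^ 2 * ((U + C u * X) ^ 2)⁻¹) = B at *
  generalize hyp2F1 γ (2 * lam - γ) (lam + 1 / 2) z = F at *
  generalize hyp2F1 γ (2 * lam - γ) (lam + 1 / 2) w = G at *
  linear_combination cpow R (-(2 * lam)) * (cpow R γ ^ 2 * G * cpow R (-γ) * kz +
    cpow R γ ^ 2 * cpow (U - C u * X) (-γ) * A * kw -
    F * G * (cpow R γ * cpow R (-γ) + 1) * hRγ)
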